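/- Let $\mathcal B$ be a Boolean algebra (with least element $\emptyset$, a largest element is not required). An action on $\mathcal B$ is a Boolean algebra homomorphism $\theta:\mathcal B\to\mathcal B$ with $\theta(\emptyset)=\emptyset$. A Boolean dynamical system $(\mathcal B,\mathcal L,\theta)$ consists of a set $\mathcal L$ and actions $\theta_a$ ($a\in\mathcal L$) such that, for every nonempty word $\alpha=\alpha_1\cdots\alpha_n$ in $\mathcal L$, the map $\theta_\alpha=\theta_{\alpha_n}\circ\cdots\circ\theta_{\alpha_1}$ has compact range (the set $\theta_\alpha(\mathcal B)$ has a least upper bound $\mathcal R_\alpha$) and closed domain (there is $\mathcal D_\alpha\in\mathcal B$ with $\theta_\alpha(\mathcal D_\alpha)=\mathcal R_\alpha$). For the empty word put $\theta_\emptyset=\mathrm{id}$ and let $\mathcal R_\emptyset$ be a formal largest element. For $A\in\mathcal B$ let $\Delta_A=\{a\in\mathcal L:\theta_a(A)\neq\emptyset\}$, and call $A$ regular if $0<|\Delta_X|<\infty$ for every $\emptyset\ne X\subseteq A$. Let $C^*(\mathcal B,\mathcal L,\theta)$ be the universal C*-algebra generated by projections $p_A$ ($A\in\mathcal B$) and partial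 isometries $s_a$ ($a\in\mathcal L$) subject to $p_\emptyset=0$, $p_Ap_{A'}=p_{A\cap A'}$, $p_{A\cup A'}=p_A+p_{A'}-p_{A\cap A'}$, $p_As_a=s_ap_{\theta_a(A)}$, $s_a^*s_b=\delta_{a,b}\,p_{\mathcal R_a}$, and $p_A=\sum_{a\in\Delta_A}s_ap_{\theta_a(A)}s_a^*$ for every regular $A$. For a word $\alpha=\alpha_1\cdots\alpha_n$ of length $|\alpha|=n$ write $s_\alpha=s_{\alpha_1}\cdots s_{\alpha_n}$ (with $s_\emptyset$ acting as the identity), and let $T$ be the inverse semigroup $$T=\{s_\alpha p_As_\beta^*:\ \alpha,\beta \text{ words},\ A\in\mathcal B,\ A\subseteq\mathcal R_\alpha\cap\mathcal R_\beta\neq\emptyset\}\cup\{0\}\subseteq C^*(\mathcal B,\mathcal L,\theta).$$ A filter in the semilattice of idempotents of $T$ (nonempty, upward closed, closed under products, not containing $0$) is tight if it meets every finite cover of each of its members; a cover of an idempotent $e$ is a set $Z$ of idempotents $\le e$ such that every nonzero idempotent $f\le e$ satisfies $zf\ne0$ for some $z\in Z$. Let $\mathcal G_{tight}(T)$ be the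 groupoid of germs $[t,\xi]$ ($t\in T$, $\xi$ a tight filter, $t^*t\in\xi$) of the action of $T$ on its tight filters, where $t\cdot\xi$ is the set of idempotents $e$ with $tft^*\le e$ for some $f\in\xi$, and $[t,\xi]=[t',\xi']$ iff $\xi=\xi'$ and $te=t'e$ for some $e\in\xi$; $[t,\xi]$ has source $\xi$ and range $t\cdot\xi$. Let $c:\mathcal G_{tight}(T)\to\mathbb Z$ be the cocycle $c([s_\alpha p_As_\beta^*,\xi])=|\alpha|-|\beta|$. Then the subgroupoid $c^{-1}(0)$ of $\mathcal G_{tight}(T)$ is principal: every element of $c^{-1}(0)$ whose source and range coincide is a unit (so the isotropy bundle of $c^{-1}(0)$ equals its unit space). -/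

import Mathlib

open CategoryTheory

universe u v w

/-! ### Inverse semigroups with zero and their tight groupoids -/

/-- An inverse semigroup with zero, presented equationally: `star x` is the (unique) generalised
inverse of `x`.  The axioms (involutive anti-multiplicative `star`, `x x* x = x`, and commutation of
the elements `x x*`) are the standard equational axioms of inverse semigroups. -/
class InverseSemigroup₀ (S : Type w) extends SemigroupWithZero S, StarMul S where
  mul_star_mul : ∀ x : S, x * star x * x = x
  comm_proj : ∀ x y : S, (x * star x) * (y * star y) = (y * star y) * (x * star x)

namespace InverseSemigroup₀

variable {S : Type w} [InverseSemigroup₀ S]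

theorem star_idem {e : S} (he : e * e = e) : star e = e := by
  have h1 : star e * star e = star e := by rw [← star_mul, he]
  have h2 : e * star e * e = e := mul_star_mul e
  have h3 := comm_proj e (star e)
  rw [star_star] at h3
  have h4 : e = e * star e * (star e * e) := by
    calc e = e * star e * e := h2.symm
      _ = e * (star e * star e) * e := by rw [h1]
      _ = e * star e * (star e * e) := by simp only [mul_assoc]
  have h5 : star e * e * (e * star e) = star e := by
    calc star e * e * (e * star e) = star e * (e * e) * star e := by simp only [mul_assoc]
      _ = star e * e * star e := by rw [he]
      _ = star e := by simpa using mul_star_mul (star e)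
  rw [h3, h5] at h4
  exact h4.symm

theorem idem_comm {e f : S} (he : e * e = e) (hf : f * f = f) : e * f = f * e := by
  have h := comm_proj e f
  rwa [star_idem he, star_idem hf, he, hf] at h

theorem idem_mul {e f : S} (he : e * e = e) (hf : f * f = f) : e * f * (e * f) = e * f := by
  calc e * f * (e * f) = e * (f * e) * f := by simp only [mul_assoc]
    _ = e * (e * f) * f := by rw [idem_comm he hf]
    _ = (e * e) * (f * f) := by simp only [mul_assoc]
    _ = e * f := by rw [he, hf]

theorem idem_star_mul (s : S) : star s * s * (star s * s) = star s * s := by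
  rw [← mul_assoc, mul_assoc (star s) s (star s), mul_assoc (star s), mul_star_mul]

theorem conj_mul (s : S) {f : S} (hf : f * f = f) : s * f * star s * s = s * f := by
  calc s * f * star s * s = s * (f * (star s * s)) := by simp only [mul_assoc]
    _ = s * (star s * s * f) := by rw [idem_comm hf (idem_star_mul s)]
    _ = (s * star s * s) * f := by simp only [mul_assoc]
    _ = s * f := by rw [mul_star_mul]

theorem conj_mul_conj (s : S) {f : S} (hf : f * f = f) (g : S) :
    s * f * star s * (s * g * star s) = s * (f * g) * star s := by
  calc s * f * star s * (s * g * star s) = (s * f * star s * s) * (g * star s) := by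
        simp only [mul_assoc]
    _ = s * (f * g) * star s := by rw [conj_mul s hf]; simp only [mul_assoc]

theorem idem_conj (s : S) {f : S} (hf : f * f = f) :
    s * f * star s * (s * f * star s) = s * f * star s := by
  rw [conj_mul_conj s hf, hf]

/-- A (proper) filter in the semilattice of idempotents of `S`; recall that the order on
idempotents is `e ≤ f ↔ e * f = e`. -/
structure IsFilter (ξ : Set S) : Prop where
  idem : ∀ e ∈ ξ, e * e = e
  nonempty : ξ.Nonempty
  zero_notMem : (0 : S) ∉ ξ
  mul_mem : ∀ e ∈ ξ, ∀ f ∈ ξ, e * f ∈ ξ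
  upward : ∀ e ∈ ξ, ∀ f : S, f * f = f → e * f = e → f ∈ ξ

/-- `Z` is a cover of the idempotent `e`: it consists of idempotents `≤ e`, and every nonzero
idempotent `f ≤ e` meets some member of `Z`. -/
structure IsCover (Z : Set S) (e : S) : Prop where
  idem : ∀ z ∈ Z, z * z = z
  le : ∀ z ∈ Z, z * e = z
  meets : ∀ f : S, f * f = f → f ≠ 0 → f * e = f → ∃ z ∈ Z, z * f ≠ 0

variable (S) in
/-- Tight filters: filters `ξ` such that every finite cover of a member of `ξ` meets `ξ`. -/
@[ext]
structure TightFilter where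
  carrier : Set S
  isFilter : IsFilter carrier
  tight : ∀ e ∈ carrier, ∀ Z : Set S, Z.Finite → IsCover Z e → ∃ z ∈ Z, z ∈ carrier

/-- The set `s · ξ = {e idempotent : ∃ f ∈ ξ, s f s* ≤ e}`. -/
def actSet (s : S) (ξ : Set S) : Set S :=
  {e | e * e = e ∧ ∃ f ∈ ξ, s * f * star s * e = s * f * star s}

theorem conj_mem_actSet (s : S) {ξ : Set S} (hξ : IsFilter ξ) {f : S} (hf : f ∈ ξ) :
    s * f * star s ∈ actSet s ξ :=
  ⟨idem_conj s (hξ.idem f hf), f, hf, idem_conj s (hξ.idem f hf)⟩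

theorem isFilter_actSet {s : S} {ξ : Set S} (hξ : IsFilter ξ) (hs : star s * s ∈ ξ) :
    IsFilter (actSet s ξ) where
  idem e he := he.1
  nonempty := ⟨_, conj_mem_actSet s hξ hs⟩
  zero_notMem := by
    rintro ⟨-, f, hf, h⟩
    rw [mul_zero] at h
    apply hξ.zero_notMem
    have h2 : star s * s * f * (star s * s) = star s * (s * f * star s) * s := by
      simp only [mul_assoc]
    rw [← h, mul_zero, zero_mul] at h2
    rw [← h2]
    exact hξ.mul_mem _ (hξ.mul_mem _ hs _ hf) _ hs
  mul_mem := by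
    rintro e ⟨he, f, hf, h⟩ e' ⟨he', f', hf', h'⟩
    refine ⟨idem_mul he he', f * f', hξ.mul_mem _ hf _ hf', ?_⟩
    rw [← conj_mul_conj s (hξ.idem f hf)]
    set a := s * f * star s
    set b := s * f' * star s
    have hb : b * b = b := idem_conj s (hξ.idem f' hf')
    calc a * b * (e * e') = a * (b * e) * e' := by simp only [mul_assoc]
      _ = a * (e * b) * e' := by rw [idem_comm hb he]
      _ = (a * e) * (b * e') := by simp only [mul_assoc]
      _ = a * b := by rw [h, h']
  upward := by
    rintro e ⟨he, f, hf, h⟩ g hg heg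
    refine ⟨hg, f, hf, ?_⟩
    rw [← h, mul_assoc, heg]

/-- The action of `S` on tight filters: for `s* s ∈ ξ`, the tight filter `s · ξ`. -/
def TightFilter.act (s : S) (ξ : TightFilter S) (hs : star s * s ∈ ξ.carrier) : TightFilter S where
  carrier := actSet s ξ.carrier
  isFilter := isFilter_actSet ξ.isFilter hs
  tight := by
    rintro e ⟨he, f₀, hf₀, h₀⟩ Z hZ hc
    have hi0 := ξ.isFilter.idem f₀ hf₀
    have hss := idem_star_mul s
    set f := f₀ * (star s * s) with hfdef
    have hf : f ∈ ξ.carrier := ξ.isFilter.mul_mem _ hf₀ _ hs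
    have hi := ξ.isFilter.idem f hf
    have hfs : f * (star s * s) = f := by rw [hfdef, mul_assoc, hss]
    have hsf : star s * s * f = f := by rw [← idem_comm hi hss, hfs]
    have hle : s * f * star s * e = s * f * star s := by
      rw [hfdef, ← conj_mul_conj s hi0]
      have hb := idem_conj s hss
      rw [mul_assoc, idem_comm hb he, ← mul_assoc, h₀]
    have hpull : ∀ z ∈ Z, star s * z * s * (star s * z * s) = star s * z * s := fun z hz => by
      simpa using idem_conj (star s) (hc.idem z hz)
    have hcov : IsCover ((fun z => star s * z * s * f) '' Z) f := by
      refine ⟨?_, ?_, ?_⟩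
      · rintro _ ⟨z, hz, rfl⟩
        exact idem_mul (hpull z hz) hi
      · rintro _ ⟨z, hz, rfl⟩
        change star s * z * s * f * f = star s * z * s * f
        rw [mul_assoc, hi]
      · intro g hg hg0 hgf
        have hfg : f * g = g := by rw [idem_comm hi hg, hgf]
        have hgss : star s * s * g = g := by rw [← hfg, ← mul_assoc, hsf]
        have hgss' : g * (star s * s) = g := by rw [idem_comm hg hss, hgss]
        have hne : s * g * star s ≠ 0 := by
          intro h
          apply hg0
          calc g = star s * s * g * (star s * s) := by rw [hgss, hgss']
            _ = star s * (s * g * star s) * s := by simp only [mul_assoc]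
            _ = 0 := by rw [h, mul_zero, zero_mul]
        have hge : s * g * star s * e = s * g * star s := by
          conv_lhs => rw [← hgf]
          rw [← conj_mul_conj s hg, mul_assoc, hle, conj_mul_conj s hg, hgf]
        obtain ⟨z, hz, hzg⟩ := hc.meets _ (idem_conj s hg) hne hge
        refine ⟨_, ⟨z, hz, rfl⟩, ?_⟩
        intro h
        apply hzg
        change star s * z * s * f * g = 0 at h
        have hzi := hc.idem z hz
        have hss' : s * star s * (s * star s) = s * star s := by
          simpa using idem_star_mul (star s)
        calc z * (s * g * star s) = z * (s * star s * s * g * star s) := by rw [mul_star_mul]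
          _ = z * (s * star s) * (s * g * star s) := by simp only [mul_assoc]
          _ = s * star s * z * (s * g * star s) := by rw [idem_comm hzi hss']
          _ = s * (star s * z * s * g) * star s := by simp only [mul_assoc]
          _ = s * (star s * z * s * f * g) * star s := by rw [mul_assoc _ f g, hfg]
          _ = 0 := by rw [h, mul_zero, zero_mul]
    obtain ⟨_, ⟨z, hz, rfl⟩, hzξ⟩ := ξ.tight f hf _ (hZ.image _) hcov
    refine ⟨z, hz, hc.idem z hz, _, hzξ, ?_⟩
    have hzi := hc.idem z hz
    have hss' : s * star s * (s * star s) = s * star s := by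
      simpa using idem_star_mul (star s)
    have key : s * (star s * z * s * f) * star s = z * (s * f * star s) := by
      calc s * (star s * z * s * f) * star s = s * star s * z * (s * f * star s) := by
            simp only [mul_assoc]
        _ = z * (s * star s) * (s * f * star s) := by rw [idem_comm hzi hss']
        _ = z * ((s * star s * s) * f * star s) := by simp only [mul_assoc]
        _ = z * (s * f * star s) := by rw [mul_star_mul]
    change s * (star s * z * s * f) * star s * z = s * (star s * z * s * f) * star s
    rw [key, mul_assoc, idem_comm (idem_conj s hi) hzi, ← mul_assoc, hzi]

theorem actSet_mul (t s : S) {ξ : Set S} (hξ : IsFilter ξ) :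
    actSet (t * s) ξ = actSet t (actSet s ξ) := by
  have e1 : ∀ f : S, t * s * f * star (t * s) = t * (s * f * star s) * star t := fun f => by
    rw [star_mul]; simp only [mul_assoc]
  ext e
  constructor
  · rintro ⟨he, f, hf, h⟩
    exact ⟨he, _, conj_mem_actSet s hξ hf, by rw [← e1, h]⟩
  · rintro ⟨he, f', ⟨hf', f, hf, h'⟩, h⟩
    refine ⟨he, f, hf, ?_⟩
    have hi := idem_conj s (hξ.idem f hf)
    rw [e1, ← h', ← conj_mul_conj t hi, mul_assoc, h]

theorem actSet_idem {ξ : Set S} (hξ : IsFilter ξ) {e : S} (he : e ∈ ξ) : actSet e ξ = ξ := by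
  have hi := hξ.idem e he
  ext g
  constructor
  · rintro ⟨hg, f, hf, h⟩
    rw [star_idem hi] at h
    exact hξ.upward _ (hξ.mul_mem _ (hξ.mul_mem _ he _ hf) _ he) g hg h
  · intro hg
    have hgi := hξ.idem g hg
    refine ⟨hgi, g, hg, ?_⟩
    rw [star_idem hi, mul_assoc (e * g), idem_comm hi hgi, mul_assoc g e (g * e), ← mul_assoc e g e,
      ← idem_comm hgi hi, mul_assoc g e e, hi, ← mul_assoc g g e, hgi]

theorem actSet_star {s : S} {ξ : Set S} (hξ : IsFilter ξ) (hs : star s * s ∈ ξ) :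
    actSet (star s) (actSet s ξ) = ξ := by
  rw [← actSet_mul _ _ hξ, actSet_idem hξ hs]

theorem mul_mem_of_mem_actSet {s g : S} {ξ : Set S} (hξ : IsFilter ξ) (hs : star s * s ∈ ξ)
    (hg : g ∈ actSet s ξ) : star s * g * s ∈ ξ := by
  have h := conj_mem_actSet (star s) (isFilter_actSet hξ hs) hg
  rwa [actSet_star hξ hs, star_star] at h

/-- Pairs `(s, ξ)` with `s* s ∈ ξ` representing the same germ have the same range, so that the range
of a germ is well defined. -/
theorem actSet_congr {s t e : S} {ξ : Set S} (hξ : IsFilter ξ) (he : e ∈ ξ)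
    (h : s * e = t * e) : actSet s ξ = actSet t ξ := by
  rw [← actSet_idem hξ he, ← actSet_mul _ _ hξ, ← actSet_mul _ _ hξ, h]

/-- Elements `s` with `s* s ∈ ξ` and `s · ξ = η`. -/
@[ext]
structure PreHom (ξ η : TightFilter S) : Type w where
  val : S
  dom : star val * val ∈ ξ.carrier
  act_eq : actSet val ξ.carrier = η.carrier

/-- Equality of germs: `[s, ξ] = [t, ξ]` iff `s e = t e` for some `e ∈ ξ`. -/
instance germSetoid (ξ η : TightFilter S) : Setoid (PreHom ξ η) where
  r s t := ∃ e ∈ ξ.carrier, s.val * e = t.val * e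
  iseqv :=
    { refl := fun _ => ⟨_, ξ.isFilter.nonempty.some_mem, rfl⟩
      symm := fun ⟨e, he, h⟩ => ⟨e, he, h.symm⟩
      trans := by
        rintro s t r ⟨e, he, h⟩ ⟨f, hf, h'⟩
        refine ⟨e * f, ξ.isFilter.mul_mem _ he _ hf, ?_⟩
        rw [← mul_assoc, h, idem_comm (ξ.isFilter.idem e he) (ξ.isFilter.idem f hf),
          mul_assoc, idem_comm (ξ.isFilter.idem e he) (ξ.isFilter.idem f hf), ← mul_assoc, h',
          mul_assoc] }

/-- The germs `[s, ξ]` with source `ξ` and range `s · ξ = η`. -/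
def Germ (ξ η : TightFilter S) : Type w := Quotient (germSetoid ξ η)

noncomputable def PreHom.one (ξ : TightFilter S) : PreHom ξ ξ where
  val := ξ.isFilter.nonempty.some
  dom := by
    have h := ξ.isFilter.nonempty.some_mem
    have hi := ξ.isFilter.idem _ h
    rw [star_idem hi, hi]; exact h
  act_eq := actSet_idem ξ.isFilter ξ.isFilter.nonempty.some_mem

def PreHom.comp {ξ η ζ : TightFilter S} (s : PreHom ξ η) (t : PreHom η ζ) : PreHom ξ ζ where
  val := t.val * s.val
  dom := by
    have h : star t.val * t.val ∈ actSet s.val ξ.carrier := by rw [s.act_eq]; exact t.dom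
    have := mul_mem_of_mem_actSet ξ.isFilter s.dom h
    rw [star_mul]
    simpa only [mul_assoc] using this
  act_eq := by rw [actSet_mul _ _ ξ.isFilter, s.act_eq, t.act_eq]

theorem PreHom.range_mem {ξ η : TightFilter S} (s : PreHom ξ η) :
    s.val * star s.val ∈ η.carrier := by
  rw [← s.act_eq]
  have := conj_mem_actSet s.val ξ.isFilter s.dom
  rwa [← mul_assoc s.val, mul_star_mul] at this

def PreHom.inv {ξ η : TightFilter S} (s : PreHom ξ η) : PreHom η ξ where
  val := star s.val
  dom := by rw [star_star]; exact s.range_mem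
  act_eq := by rw [← s.act_eq, actSet_star ξ.isFilter s.dom]

theorem PreHom.comp_congr {ξ η ζ : TightFilter S} {s s' : PreHom ξ η} {t t' : PreHom η ζ}
    (hs : s ≈ s') (ht : t ≈ t') : s.comp t ≈ s'.comp t' := by
  obtain ⟨e, he, h⟩ := hs
  obtain ⟨f, hf, h'⟩ := ht
  rw [← s.act_eq] at hf
  obtain ⟨hfi, k, hk, hkf⟩ := hf
  have hki := ξ.isFilter.idem k hk
  have hei := ξ.isFilter.idem e he
  refine ⟨k * e, ξ.isFilter.mul_mem _ hk _ he, ?_⟩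
  change t.val * s.val * (k * e) = t'.val * s'.val * (k * e)
  have h1 : f * (s.val * k) = s.val * k := by
    rw [← conj_mul s.val hki, ← mul_assoc f, idem_comm hfi (idem_conj s.val hki), hkf]
  calc t.val * s.val * (k * e) = t.val * (s.val * k) * e := by simp only [mul_assoc]
    _ = t.val * (f * (s.val * k)) * e := by rw [h1]
    _ = (t.val * f) * (s.val * k) * e := by simp only [mul_assoc]
    _ = t'.val * (f * (s.val * k)) * e := by rw [h']; simp only [mul_assoc]
    _ = t'.val * (s.val * (k * e)) := by rw [h1]; simp only [mul_assoc]
    _ = t'.val * (s.val * e * k) := by rw [idem_comm hki hei]; simp only [mul_assoc]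
    _ = t'.val * s'.val * (k * e) := by rw [h, idem_comm hki hei]; simp only [mul_assoc]

theorem PreHom.inv_congr {ξ η : TightFilter S} {s t : PreHom ξ η} (hs : s ≈ t) :
    s.inv ≈ t.inv := by
  obtain ⟨e, he, h⟩ := hs
  have hei := ξ.isFilter.idem e he
  have h2 : e * star s.val = e * star t.val := by
    have := congrArg star h
    rwa [star_mul, star_mul, star_idem hei] at this
  refine ⟨s.val * e * star s.val, by rw [← s.act_eq]; exact conj_mem_actSet _ ξ.isFilter he, ?_⟩
  change star s.val * (s.val * e * star s.val) = star t.val * (s.val * e * star s.val)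
  have key : ∀ r : S, star r * (r * e * star r) = e * star r := fun r => by
    calc star r * (r * e * star r) = star r * r * e * star r := by simp only [mul_assoc]
      _ = e * (star r * r) * star r := by rw [idem_comm (idem_star_mul r) hei]
      _ = e * (star r * star (star r) * star r) := by simp only [mul_assoc, star_star]
      _ = e * star r := by rw [mul_star_mul]
  rw [key, h, mul_assoc, h2]
  rw [← mul_assoc t.val, key]

/-- The tight groupoid of `S`: the groupoid of germs of the action of `S` on its space of tight
filters.  Its objects (units) are the tight filters, an arrow `ξ ⟶ η` is a germ `[s, ξ]` with source
`ξ` and range `s · ξ = η`; the composite `[s, ξ] ≫ [t, s · ξ]` is `[t s, ξ]`, the unit at `ξ` is the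
germ `[e, ξ]` of any `e ∈ ξ`, and the inverse of `[s, ξ]` is `[s*, s · ξ]`. -/
noncomputable instance tightGroupoid : Groupoid (TightFilter S) where
  Hom := Germ
  id ξ := Quotient.mk _ (PreHom.one ξ)
  comp p q := Quotient.map₂ PreHom.comp (fun _ _ hs _ _ ht => PreHom.comp_congr hs ht) p q
  inv p := Quotient.map PreHom.inv (fun _ _ hs => PreHom.inv_congr hs) p
  id_comp {ξ η} p := by
    induction p using Quotient.inductionOn with
    | _ s =>
      refine Quotient.sound ⟨_, ξ.isFilter.nonempty.some_mem, ?_⟩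
      change s.val * _ * _ = s.val * _
      rw [mul_assoc]
      congr 1
      exact ξ.isFilter.idem _ ξ.isFilter.nonempty.some_mem
  comp_id {ξ η} p := by
    induction p using Quotient.inductionOn with
    | _ s =>
      have he := η.isFilter.nonempty.some_mem
      set e := η.isFilter.nonempty.some with hedef
      have he' := he
      rw [← s.act_eq] at he'
      obtain ⟨hi, f, hf, h⟩ := he'
      have hfi := ξ.isFilter.idem f hf
      refine Quotient.sound ⟨f, hf, ?_⟩
      change e * s.val * f = s.val * f
      rw [mul_assoc, ← conj_mul s.val hfi, ← mul_assoc e, idem_comm hi (idem_conj s.val hfi), h]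
  assoc {_ _ _ _} p q r := by
    induction p using Quotient.inductionOn with
    | _ s =>
    induction q using Quotient.inductionOn with
    | _ t =>
    induction r using Quotient.inductionOn with
    | _ k =>
      refine congrArg (Quotient.mk _) (PreHom.ext ?_)
      change k.val * (t.val * s.val) = k.val * t.val * s.val
      rw [mul_assoc]
  inv_comp {ξ η} p := by
    induction p using Quotient.inductionOn with
    | _ s =>
      have he := η.isFilter.nonempty.some_mem
      have hsi := η.isFilter.idem _ s.range_mem
      have hei := η.isFilter.idem _ he
      refine Quotient.sound ⟨_, η.isFilter.mul_mem _ s.range_mem _ he, ?_⟩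
      change s.val * star s.val * (s.val * star s.val * η.isFilter.nonempty.some) =
        η.isFilter.nonempty.some * (s.val * star s.val * η.isFilter.nonempty.some)
      rw [← mul_assoc, hsi, idem_comm hsi hei]
      simp only [← mul_assoc, hei]
  comp_inv {ξ η} p := by
    induction p using Quotient.inductionOn with
    | _ s =>
      have he := ξ.isFilter.nonempty.some_mem
      have hsi := ξ.isFilter.idem _ s.dom
      have hei := ξ.isFilter.idem _ he
      refine Quotient.sound ⟨_, ξ.isFilter.mul_mem _ s.dom _ he, ?_⟩
      change star s.val * s.val * (star s.val * s.val * ξ.isFilter.nonempty.some) =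
        ξ.isFilter.nonempty.some * (star s.val * s.val * ξ.isFilter.nonempty.some)
      rw [← mul_assoc, hsi, idem_comm hsi hei]
      simp only [← mul_assoc, hei]

/-- The germ `[s, ξ]`, as an arrow of the tight groupoid. -/
def germ {ξ η : TightFilter S} (s : S) (hs : star s * s ∈ ξ.carrier)
    (h : actSet s ξ.carrier = η.carrier) : ξ ⟶ η :=
  Quotient.mk (germSetoid ξ η) ⟨s, hs, h⟩

end InverseSemigroup₀

/-! ### Principal groupoids -/

/-- The isotropy bundle of a groupoid: all arrows whose source and range coincide. -/
def isotropyBundle (G : Type u) [Groupoid.{v} G] : Set (Σ x y : G, x ⟶ y) :=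
  {γ | γ.1 = γ.2.1}

/-- The unit space of a groupoid, as a set of arrows. -/
def unitArrows (G : Type u) [Groupoid.{v} G] : Set (Σ x y : G, x ⟶ y) :=
  Set.range fun x : G => ⟨x, x, 𝟙 x⟩

/-- A groupoid is principal if its isotropy bundle is its unit space. -/
def IsPrincipalGroupoid (G : Type u) [Groupoid.{v} G] : Prop :=
  isotropyBundle G = unitArrows G

/-! ### Boolean dynamical systems -/

/-- An action on a (possibly non-unital) Boolean algebra: a homomorphism of Boolean algebras sending
`⊥` to `⊥`. -/
structure IsBooleanAction {B : Type u} [GeneralizedBooleanAlgebra B] (θ : B → B) : Prop where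
  map_bot : θ ⊥ = ⊥
  map_sup : ∀ x y, θ (x ⊔ y) = θ x ⊔ θ y
  map_inf : ∀ x y, θ (x ⊓ y) = θ x ⊓ θ y
  map_sdiff : ∀ x y, θ (x \ y) = θ x \ θ y

/-- The composite `θ_{α_n} ∘ ⋯ ∘ θ_{α_1}` for a word `α = α_1 ⋯ α_n` (the identity for the empty
word). -/
def wordAct {B : Type u} {L : Type v} (θ : L → B → B) (α : List L) (A : B) : B :=
  α.foldl (fun X a => θ a X) A

/-- A Boolean dynamical system `(B, L, θ)`: every `θ_α` with `α` a nonempty word has compact range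
(a least upper bound `R_α` of all `θ_α(A)` exists) and closed domain (`θ_α(D_α) = R_α` for some
`D_α`). -/
structure BooleanDynamicalSystem (B : Type u) [GeneralizedBooleanAlgebra B] (L : Type v) where
  θ : L → B → B
  isAction : ∀ a, IsBooleanAction (θ a)
  compactRange : ∀ α : List L, α ≠ [] → ∃ R, IsLUB (Set.range (wordAct θ α)) R
  closedDomain : ∀ α : List L, α ≠ [] → ∃ D, IsLUB (Set.range (wordAct θ α)) (wordAct θ α D)

namespace BooleanDynamicalSystem

open InverseSemigroup₀

variable {B : Type u} [GeneralizedBooleanAlgebra B] {L : Type v} (D : BooleanDynamicalSystem B L)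

/-- The range `R_α` of `θ_α`, for a nonempty word `α`. -/
noncomputable def R (α : List L) (h : α ≠ []) : B := (D.compactRange α h).choose

/-- The range `R_α` of an arbitrary word, in `B` with a formal largest element adjoined; for the
empty word it is this formal largest element. -/
noncomputable def Rng : List L → WithTop B
  | [] => ⊤
  | a :: α => (D.R (a :: α) (List.cons_ne_nil a α) : B)

/-- `Δ_A = {a : θ_a(A) ≠ ∅}`. -/
def Δ (A : B) : Set L := {a | D.θ a A ≠ ⊥}

/-- Regular sets: `0 < |Δ_X| < ∞` for all `∅ ≠ X ⊆ A` (so `∅` is regular). -/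
def IsRegular (A : B) : Prop :=
  ∀ X, X ≠ ⊥ → X ≤ A → (D.Δ X).Nonempty ∧ (D.Δ X).Finite

/-- Cuntz-Krieger representations of a Boolean dynamical system in a C*-algebra `C`.  In the last
condition the index set is finite. -/
structure IsCKRep {C : Type w} [NonUnitalCStarAlgebra C] (P : B → C) (S : L → C) : Prop where
  projection : ∀ A, IsStarProjection (P A)
  partial_isometry : ∀ a, S a * star (S a) * S a = S a
  bot : P ⊥ = 0
  inf : ∀ A A', P A * P A' = P (A ⊓ A')
  sup : ∀ A A', P (A ⊔ A') = P A + P A' - P (A ⊓ A')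
  comm : ∀ a A, P A * S a = S a * P (D.θ a A)
  star_mul_self : ∀ a, star (S a) * S a = P (D.R [a] (List.cons_ne_nil a []))
  star_mul_of_ne : ∀ a b, a ≠ b → star (S a) * S b = 0
  regular : ∀ A, D.IsRegular A →
    P A = ∑ᶠ (a : L) (_ : a ∈ D.Δ A), S a * P (D.θ a A) * star (S a)

/-- A Cuntz-Krieger representation in some C*-algebra.  Every Cuntz-Krieger representation generates
a C*-algebra which is, up to isomorphism, in this universe. -/
structure CKRep where
  C : Type (max u v)
  [inst : NonUnitalCStarAlgebra C]
  P : B → C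
  S : L → C
  isRep : D.IsCKRep P S

attribute [instance] CKRep.inst

section rep

variable {D}
variable {C : Type w} [NonUnitalCStarAlgebra C] {P : B → C} {S : L → C}

theorem IsCKRep.norm_P_le (h : D.IsCKRep P S) (A : B) : ‖P A‖ ≤ 1 := by
  have h1 := CStarRing.norm_star_mul_self (x := P A)
  rw [(h.projection A).isSelfAdjoint.star_eq, (h.projection A).isIdempotentElem.eq] at h1
  nlinarith [norm_nonneg (P A)]

theorem IsCKRep.norm_S_le (h : D.IsCKRep P S) (a : L) : ‖S a‖ ≤ 1 := by
  have h1 := CStarRing.norm_star_mul_self (x := S a)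
  rw [h.star_mul_self] at h1
  have := h.norm_P_le (D.R [a] (List.cons_ne_nil a []))
  nlinarith [norm_nonneg (S a)]

end rep

/-- The product (of bounded families) of all Cuntz-Krieger representations. -/
abbrev BigProd : Type (max u v + 1) := lp (fun i : D.CKRep => i.C) ⊤

noncomputable def bigP (A : B) : D.BigProd :=
  ⟨fun i => i.P A, memℓp_infty ⟨1, by rintro _ ⟨i, rfl⟩; exact i.isRep.norm_P_le A⟩⟩

noncomputable def bigS (a : L) : D.BigProd :=
  ⟨fun i => i.S a, memℓp_infty ⟨1, by rintro _ ⟨i, rfl⟩; exact i.isRep.norm_S_le a⟩⟩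

/-- The closed star-subalgebra generated by the product of all Cuntz-Krieger representations. -/
noncomputable def universalSubalgebra : NonUnitalStarSubalgebra ℂ D.BigProd :=
  (NonUnitalStarAlgebra.adjoin ℂ (Set.range D.bigP ∪ Set.range D.bigS)).topologicalClosure

/-- The C*-algebra `C*(B, L, θ)` of the Boolean dynamical system, generated by the universal
Cuntz-Krieger representation (see `isCKRep_universal` and `exists_hom` below). -/
abbrev CStar : Type (max u v + 1) := D.universalSubalgebra

noncomputable instance : NonUnitalCStarAlgebra D.CStar :=
  NonUnitalStarSubalgebra.nonUnitalCStarAlgebra _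
    (h_closed := NonUnitalStarSubalgebra.isClosed_topologicalClosure _)

/-- The universal projections `p_A`. -/
noncomputable def p (A : B) : D.CStar :=
  ⟨D.bigP A, NonUnitalStarSubalgebra.le_topologicalClosure _
    (NonUnitalStarAlgebra.subset_adjoin ℂ _ (Or.inl ⟨A, rfl⟩))⟩

/-- The universal partial isometries `s_a`. -/
noncomputable def s (a : L) : D.CStar :=
  ⟨D.bigS a, NonUnitalStarSubalgebra.le_topologicalClosure _
    (NonUnitalStarAlgebra.subset_adjoin ℂ _ (Or.inr ⟨a, rfl⟩))⟩

/-- The component of an element of `C*(B, L, θ)` in a given representation. -/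
noncomputable def ev (i : D.CKRep) : D.CStar →⋆ₙₐ[ℂ] i.C where
  toFun x := x.1 i
  map_smul' _ _ := rfl
  map_zero' := rfl
  map_add' _ _ := rfl
  map_mul' _ _ := rfl
  map_star' _ := rfl

theorem ext_ev {x y : D.CStar} (h : ∀ i, D.ev i x = D.ev i y) : x = y :=
  Subtype.ext (lp.ext (funext h))

@[simp] theorem ev_p (i : D.CKRep) (A : B) : D.ev i (D.p A) = i.P A := rfl
@[simp] theorem ev_s (i : D.CKRep) (a : L) : D.ev i (D.s a) = i.S a := rfl

/-- `p`, `s` is a Cuntz-Krieger representation. -/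
theorem isCKRep_universal : D.IsCKRep D.p D.s where
  projection A := by
    refine ⟨D.ext_ev fun i => ?_, D.ext_ev fun i => ?_⟩
    · simpa using (i.isRep.projection A).isIdempotentElem.eq
    · simpa [map_star] using (i.isRep.projection A).isSelfAdjoint.star_eq
  partial_isometry a := D.ext_ev fun i => by
    simpa [map_star] using i.isRep.partial_isometry a
  bot := D.ext_ev fun i => by simpa using i.isRep.bot
  inf A A' := D.ext_ev fun i => by simpa using i.isRep.inf A A'
  sup A A' := D.ext_ev fun i => by simpa using i.isRep.sup A A'
  comm a A := D.ext_ev fun i => by simpa using i.isRep.comm a A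
  star_mul_self a := D.ext_ev fun i => by simpa [map_star] using i.isRep.star_mul_self a
  star_mul_of_ne a b h := D.ext_ev fun i => by
    simpa [map_star] using i.isRep.star_mul_of_ne a b h
  regular A hA := D.ext_ev fun i => by
    have hfin : (D.Δ A).Finite := by
      by_cases h : A = ⊥
      · have : D.Δ A = ∅ := by
          ext a; simp [Δ, h, (D.isAction a).map_bot]
        rw [this]; exact Set.finite_empty
      · exact (hA A h le_rfl).2
    rw [ev_p, i.isRep.regular A hA, finsum_mem_eq_finite_toFinset_sum _ hfin,
      finsum_mem_eq_finite_toFinset_sum _ hfin, map_sum]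
    simp [map_star]

/-- The universal property of `p`, `s`. -/
theorem exists_hom {C : Type (max u v)} [NonUnitalCStarAlgebra C] {P : B → C} {S : L → C}
    (h : D.IsCKRep P S) :
    ∃ π : D.CStar →⋆ₙₐ[ℂ] C, (∀ A, π (D.p A) = P A) ∧ ∀ a, π (D.s a) = S a :=
  ⟨D.ev ⟨C, P, S, h⟩, fun _ => rfl, fun _ => rfl⟩

/-! ### The inverse semigroup `T` -/

/-- Left multiplication by `s_α = s_{α_1} ⋯ s_{α_n}` (the identity for the empty word). -/
noncomputable def sMul (α : List L) (x : D.CStar) : D.CStar :=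
  α.foldr (fun a y => D.s a * y) x

/-- The element `s_α p_A s_β^* = (s_α p_A) (s_β p_A)^*` of `C*(B, L, θ)`. -/
noncomputable def elt (α : List L) (A : B) (β : List L) : D.CStar :=
  D.sMul α (D.p A) * star (D.sMul β (D.p A))

/-- The set `T = {s_α p_A s_β^* : A ⊆ R_α ∩ R_β ≠ ∅} ∪ {0}`. -/
def TSet : Set D.CStar :=
  {x | ∃ (α : List L) (A : B) (β : List L), (A : WithTop B) ≤ D.Rng α ⊓ D.Rng β ∧
    D.Rng α ⊓ D.Rng β ≠ ⊥ ∧ x = D.elt α A β} ∪ {0}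

section lemmas

variable {D}

theorem wordAct_inf (α : List L) (A A' : B) :
    wordAct D.θ α (A ⊓ A') = wordAct D.θ α A ⊓ wordAct D.θ α A' := by
  induction α generalizing A A' with
  | nil => rfl
  | cons a α ih =>
    change wordAct D.θ α (D.θ a (A ⊓ A')) = _
    rw [(D.isAction a).map_inf, ih]; rfl

theorem wordAct_mono (α : List L) {A A' : B} (h : A ≤ A') :
    wordAct D.θ α A ≤ wordAct D.θ α A' := by
  rw [← inf_eq_left, ← wordAct_inf, inf_eq_left.2 h]

theorem wordAct_le_R (α : List L) (h : α ≠ []) (A : B) : wordAct D.θ α A ≤ D.R α h :=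
  (D.compactRange α h).choose_spec.1 ⟨A, rfl⟩

theorem exists_R_eq (α : List L) (h : α ≠ []) : ∃ X, D.R α h = wordAct D.θ α X := by
  obtain ⟨X, hX⟩ := D.closedDomain α h
  exact ⟨X, (D.compactRange α h).choose_spec.unique hX⟩

theorem R_cons (a : L) (α : List L) :
    D.R (a :: α) (List.cons_ne_nil a α) = wordAct D.θ α (D.R [a] (List.cons_ne_nil a [])) := by
  apply le_antisymm
  · obtain ⟨X, hX⟩ := exists_R_eq (D := D) (a :: α) (List.cons_ne_nil a α)
    rw [hX]
    exact wordAct_mono α (wordAct_le_R [a] (List.cons_ne_nil a []) X)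
  · obtain ⟨X, hX⟩ := exists_R_eq (D := D) [a] (List.cons_ne_nil a [])
    rw [hX]
    exact wordAct_le_R (a :: α) (List.cons_ne_nil a α) X

theorem wordAct_R_le_Rng (a : L) (α : List L) :
    ((wordAct D.θ α (D.R [a] (List.cons_ne_nil a [])) : B) : WithTop B) ≤ D.Rng α := by
  cases α with
  | nil => exact le_top
  | cons b α => exact WithTop.coe_le_coe.2 (wordAct_le_R _ _ _)

theorem sMul_cons (a : L) (α : List L) (x : D.CStar) :
    D.sMul (a :: α) x = D.s a * D.sMul α x := rfl

theorem sMul_append (α β : List L) (x : D.CStar) :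
    D.sMul (α ++ β) x = D.sMul α (D.sMul β x) := by
  simp [sMul]

theorem sMul_mul (α : List L) (x y : D.CStar) : D.sMul α x * y = D.sMul α (x * y) := by
  induction α with
  | nil => rfl
  | cons a α ih => rw [sMul_cons, mul_assoc, ih, sMul_cons]

theorem star_p (A : B) : star (D.p A) = D.p A := (D.isCKRep_universal.projection A).isSelfAdjoint

theorem p_mul (A A' : B) : D.p A * D.p A' = D.p (A ⊓ A') := D.isCKRep_universal.inf A A'

theorem p_mul_sMul (A : B) (α : List L) (x : D.CStar) :
    D.p A * D.sMul α x = D.sMul α (D.p (wordAct D.θ α A) * x) := by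
  induction α generalizing A with
  | nil => rfl
  | cons a α ih =>
    rw [sMul_cons, ← mul_assoc, D.isCKRep_universal.comm, mul_assoc, ih]; rfl

theorem s_eq (a : L) : D.s a = D.s a * D.p (D.R [a] (List.cons_ne_nil a [])) := by
  rw [← D.isCKRep_universal.star_mul_self, ← mul_assoc, D.isCKRep_universal.partial_isometry]

/-- `s_α p_A` only depends on the part of `A` below `R_α`. -/
theorem exists_sMul_eq (α : List L) : ∃ f : B → B, ∀ A, f A ≤ A ∧ ((f A : B) : WithTop B) ≤ D.Rng α ∧
    ∀ A', A' ≤ A → D.sMul α (D.p A') = D.sMul α (D.p (A' ⊓ f A)) := by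
  cases α with
  | nil => exact ⟨id, fun A => ⟨le_rfl, le_top, fun A' h => by rw [id, inf_eq_left.2 h]⟩⟩
  | cons a α =>
    refine ⟨fun A => D.R (a :: α) (List.cons_ne_nil a α) ⊓ A,
      fun A => ⟨inf_le_right, WithTop.coe_le_coe.2 inf_le_left, fun A' h => ?_⟩⟩
    have key : ∀ X, D.sMul (a :: α) (D.p X) =
        D.sMul (a :: α) (D.p (D.R (a :: α) (List.cons_ne_nil a α) ⊓ X)) := fun X => by
      conv_lhs => rw [sMul_cons, s_eq, mul_assoc, p_mul_sMul, p_mul, ← R_cons]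
      rfl
    change _ = D.sMul (a :: α) (D.p (A' ⊓ (_ ⊓ A)))
    rw [key A', inf_left_comm A', inf_eq_left.2 h]

theorem sMul_mul_star_sMul (α β : List L) (A A' : B) :
    D.sMul α (D.p A) * star (D.sMul β (D.p A')) = D.elt α (A ⊓ A') β := by
  have H : ∀ X Y, D.sMul α (D.p X) * star (D.sMul β (D.p Y)) =
      D.sMul α (star (D.sMul β (D.p (Y ⊓ X)))) := fun X Y => by
    rw [sMul_mul, ← star_p X, ← star_mul, sMul_mul, p_mul]
  rw [elt, H, H, inf_idem, inf_comm]

theorem elt_mem (α : List L) (A : B) (β : List L) : D.elt α A β ∈ D.TSet := by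
  obtain ⟨f, hf⟩ := exists_sMul_eq (D := D) α
  obtain ⟨g, hg⟩ := exists_sMul_eq (D := D) β
  have h : D.elt α A β = D.elt α (f A ⊓ g A) β := by
    rw [elt, (hf A).2.2 A le_rfl, (hg A).2.2 A le_rfl, sMul_mul_star_sMul,
      inf_eq_right.2 (hf A).1, inf_eq_right.2 (hg A).1]
  rw [h]
  by_cases h0 : f A ⊓ g A = ⊥
  · right
    rw [h0, elt, D.isCKRep_universal.bot]
    have : D.sMul α 0 = 0 := by
      have := sMul_mul (D := D) α 0 0
      rwa [mul_zero, mul_zero, eq_comm] at this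
    rw [this, zero_mul]; rfl
  · left
    have hle : ((f A ⊓ g A : B) : WithTop B) ≤ D.Rng α ⊓ D.Rng β :=
      le_inf ((WithTop.coe_le_coe.2 inf_le_left).trans (hf A).2.1)
        ((WithTop.coe_le_coe.2 inf_le_right).trans (hg A).2.1)
    refine ⟨α, _, β, hle, fun hb => h0 ?_, rfl⟩
    rw [hb] at hle
    exact WithTop.coe_injective (le_bot_iff.1 hle)

theorem mem_TSet_iff {x : D.CStar} : x ∈ D.TSet ↔ ∃ (α : List L) (A : B) (β : List L), x = D.elt α A β := by
  constructor
  · rintro (⟨α, A, β, -, -, h⟩ | h)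
    · exact ⟨α, A, β, h⟩
    · refine ⟨[], ⊥, [], ?_⟩
      rw [Set.mem_singleton_iff.1 h, elt]
      change 0 = D.p ⊥ * star (D.p ⊥)
      rw [D.isCKRep_universal.bot, zero_mul]
  · rintro ⟨α, A, β, rfl⟩
    exact elt_mem α A β

/-- The products `(s_α p_A)^* (s_β p_A')`. -/
theorem star_sMul_mul (α β : List L) (A A' : B) :
    (∃ ε X, β = α ++ ε ∧ star (D.sMul α (D.p A)) * D.sMul β (D.p A') = D.sMul ε (D.p X)) ∨
    (∃ ε X, α = β ++ ε ∧ star (D.sMul α (D.p A)) * D.sMul β (D.p A') = star (D.sMul ε (D.p X))) ∨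
    star (D.sMul α (D.p A)) * D.sMul β (D.p A') = 0 := by
  induction α generalizing β A' with
  | nil =>
    left
    refine ⟨β, wordAct D.θ β A ⊓ A', rfl, ?_⟩
    change star (D.p A) * _ = _
    rw [star_p, p_mul_sMul, p_mul]
  | cons a α ih =>
    cases β with
    | nil =>
      right; left
      refine ⟨a :: α, wordAct D.θ (a :: α) A' ⊓ A, rfl, ?_⟩
      change _ * D.p A' = _
      rw [← p_mul, ← p_mul_sMul, star_mul, star_p]
    | cons b β =>
      have e : star (D.sMul (a :: α) (D.p A)) * D.sMul (b :: β) (D.p A') =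
          star (D.sMul α (D.p A)) * ((star (D.s a) * D.s b) * D.sMul β (D.p A')) := by
        rw [sMul_cons, sMul_cons, star_mul]; simp only [mul_assoc]
      by_cases hab : a = b
      · subst hab
        rw [D.isCKRep_universal.star_mul_self, p_mul_sMul, p_mul] at e
        rw [e]
        rcases ih β (wordAct D.θ β (D.R [a] (List.cons_ne_nil a [])) ⊓ A') with
          ⟨ε, X, h, h'⟩ | ⟨ε, X, h, h'⟩ | h'
        · exact Or.inl ⟨ε, X, by rw [h]; rfl, h'⟩
        · exact Or.inr (Or.inl ⟨ε, X, by rw [h]; rfl, h'⟩)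
        · exact Or.inr (Or.inr h')
      · right; right
        rw [e, D.isCKRep_universal.star_mul_of_ne a b hab, zero_mul, mul_zero]

theorem star_sMul_mul_self (α : List L) (A : B) (h : (A : WithTop B) ≤ D.Rng α) :
    star (D.sMul α (D.p A)) * D.sMul α (D.p A) = D.p A := by
  induction α with
  | nil =>
    change star (D.p A) * D.p A = _
    rw [star_p, p_mul, inf_idem]
  | cons a α ih =>
    have h1 : A ≤ wordAct D.θ α (D.R [a] (List.cons_ne_nil a [])) := by
      rw [← R_cons]; exact WithTop.coe_le_coe.1 h
    rw [sMul_cons, star_mul, mul_assoc, ← mul_assoc (star (D.s a)),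
      D.isCKRep_universal.star_mul_self, p_mul_sMul, p_mul, inf_eq_right.2 h1]
    exact ih ((WithTop.coe_le_coe.2 h1).trans (wordAct_R_le_Rng a α))

theorem star_elt (α : List L) (A : B) (β : List L) : star (D.elt α A β) = D.elt β A α := by
  rw [elt, elt, star_mul, star_star]

theorem star_mem_TSet {x : D.CStar} (hx : x ∈ D.TSet) : star x ∈ D.TSet := by
  obtain ⟨α, A, β, rfl⟩ := mem_TSet_iff.1 hx
  rw [star_elt]; exact elt_mem _ _ _

theorem elt_mul_elt (α β γ δ : List L) (A A' : B) :
    (∃ ε X, γ = β ++ ε ∧ D.elt α A β * D.elt γ A' δ = D.elt (α ++ ε) X δ) ∨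
    (∃ ε X, β = γ ++ ε ∧ D.elt α A β * D.elt γ A' δ = D.elt α X (δ ++ ε)) ∨
    D.elt α A β * D.elt γ A' δ = 0 := by
  have e : D.elt α A β * D.elt γ A' δ = D.sMul α (D.p A) *
      (star (D.sMul β (D.p A)) * D.sMul γ (D.p A')) * star (D.sMul δ (D.p A')) := by
    rw [elt, elt]; simp only [mul_assoc]
  rcases star_sMul_mul (D := D) β γ A A' with ⟨ε, X, h, h'⟩ | ⟨ε, X, h, h'⟩ | h'
  · left
    exact ⟨ε, wordAct D.θ ε A ⊓ X ⊓ A', h, by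
      rw [e, h', sMul_mul α, p_mul_sMul, ← sMul_append, p_mul, sMul_mul_star_sMul]⟩
  · right; left
    exact ⟨ε, A ⊓ (wordAct D.θ ε A' ⊓ X), h, by
      rw [e, h', mul_assoc, ← star_mul, sMul_mul δ, p_mul_sMul, ← sMul_append, p_mul,
        sMul_mul_star_sMul]⟩
  · right; right
    rw [e, h', mul_zero, zero_mul]

theorem mul_mem_TSet {x y : D.CStar} (hx : x ∈ D.TSet) (hy : y ∈ D.TSet) : x * y ∈ D.TSet := by
  obtain ⟨α, A, β, rfl⟩ := mem_TSet_iff.1 hx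
  obtain ⟨γ, A', δ, rfl⟩ := mem_TSet_iff.1 hy
  rcases elt_mul_elt (D := D) α β γ δ A A' with ⟨ε, X, -, h⟩ | ⟨ε, X, -, h⟩ | h <;> rw [h]
  · exact elt_mem _ _ _
  · exact elt_mem _ _ _
  · exact Or.inr rfl

theorem elt_mul_star (α β : List L) (A : B) : ∃ X, D.elt α A β * star (D.elt α A β) = D.elt α X α := by
  rw [star_elt]
  have h0 : D.elt α ⊥ α = 0 := by
    rw [elt, D.isCKRep_universal.bot]
    have : D.sMul α 0 = 0 := by
      have := sMul_mul (D := D) α 0 0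
      rwa [mul_zero, mul_zero, eq_comm] at this
    rw [this, zero_mul]
  rcases elt_mul_elt (D := D) α β β α A A with ⟨ε, X, h, h'⟩ | ⟨ε, X, h, h'⟩ | h'
  · obtain rfl : ε = [] := List.self_eq_append_right.1 h
    rw [List.append_nil] at h'; exact ⟨X, h'⟩
  · obtain rfl : ε = [] := List.self_eq_append_right.1 h
    rw [List.append_nil] at h'; exact ⟨X, h'⟩
  · exact ⟨⊥, by rw [h', h0]⟩

theorem elt_comm (α β : List L) (A A' : B) :
    D.elt α A α * D.elt β A' β = D.elt β A' β * D.elt α A α := by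
  have key : star (D.elt α A α * D.elt β A' β) = D.elt α A α * D.elt β A' β := by
    rcases elt_mul_elt (D := D) α α β β A A' with ⟨ε, X, h, h'⟩ | ⟨ε, X, h, h'⟩ | h'
    · rw [h', star_elt, ← h]
    · rw [h', star_elt, ← h]
    · rw [h', star_zero]
  rw [star_mul, star_elt, star_elt] at key
  exact key.symm

end lemmas

/-- `T` as a type. -/
abbrev T : Type (max u v + 1) := D.TSet

/-- `T` is an inverse semigroup under the multiplication and involution of `C*(B, L, θ)`. -/
noncomputable instance : InverseSemigroup₀ D.T where
  mul x y := ⟨x.1 * y.1, mul_mem_TSet x.2 y.2⟩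
  mul_assoc x y z := Subtype.ext (mul_assoc x.1 y.1 z.1)
  zero := ⟨0, Or.inr rfl⟩
  zero_mul x := Subtype.ext (zero_mul x.1)
  mul_zero x := Subtype.ext (mul_zero x.1)
  star x := ⟨star x.1, star_mem_TSet x.2⟩
  star_involutive x := Subtype.ext (star_star x.1)
  star_mul x y := Subtype.ext (star_mul x.1 y.1)
  mul_star_mul x := by
    apply Subtype.ext
    change x.1 * star x.1 * x.1 = x.1
    rcases x.2 with ⟨α, A, β, h, -, hx⟩ | hx
    · have h2 : (A : WithTop B) ≤ D.Rng β := h.trans inf_le_right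
      have h1 : (A : WithTop B) ≤ D.Rng α := h.trans inf_le_left
      rw [hx, star_elt, elt, elt]
      calc D.sMul α (D.p A) * star (D.sMul β (D.p A)) * (D.sMul β (D.p A) * star (D.sMul α (D.p A))) *
            (D.sMul α (D.p A) * star (D.sMul β (D.p A)))
          = D.sMul α (D.p A) * (star (D.sMul β (D.p A)) * D.sMul β (D.p A)) *
            (star (D.sMul α (D.p A)) * D.sMul α (D.p A)) * star (D.sMul β (D.p A)) := by
              simp only [mul_assoc]
        _ = _ := by
              rw [star_sMul_mul_self β A h2, star_sMul_mul_self α A h1, sMul_mul, sMul_mul, p_mul,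
                p_mul, inf_idem, inf_idem]
    · rw [Set.mem_singleton_iff.1 hx, mul_zero]
  comm_proj x y := by
    apply Subtype.ext
    change x.1 * star x.1 * (y.1 * star y.1) = y.1 * star y.1 * (x.1 * star x.1)
    obtain ⟨α, A, β, hx⟩ := mem_TSet_iff.1 x.2
    obtain ⟨γ, A', δ, hy⟩ := mem_TSet_iff.1 y.2
    obtain ⟨X, hX⟩ := elt_mul_star (D := D) α β A
    obtain ⟨Y, hY⟩ := elt_mul_star (D := D) γ δ A'
    rw [hx, hy, hX, hY, elt_comm]

/-- The tight groupoid `𝒢_tight(T)`; its unit space is the space of tight filters of `T`. -/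
abbrev Gtight : Type (max u v + 1) := TightFilter D.T

/-! ### The cocycle `c` -/

section gauge

variable {D}

/-- The representation `P`, `z S`, for `z` in the unit circle. -/
noncomputable def CKRep.twist (i : D.CKRep) (z : Circle) : D.CKRep where
  C := i.C
  P := i.P
  S a := (z : ℂ) • i.S a
  isRep :=
    have hz : (z : ℂ) * star (z : ℂ) = 1 := by
      rw [Complex.star_def, Complex.mul_conj, Circle.normSq_coe]; simp
    have hz' : star (z : ℂ) * (z : ℂ) = 1 := by rw [mul_comm, hz]
    { projection := i.isRep.projection
      partial_isometry := fun a => by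
        simp only [star_smul, smul_mul_assoc, mul_smul_comm, smul_smul]
        rw [hz', mul_one, i.isRep.partial_isometry]
      bot := i.isRep.bot
      inf := i.isRep.inf
      sup := i.isRep.sup
      comm := fun a A => by
        simp only [smul_mul_assoc, mul_smul_comm, i.isRep.comm]
      star_mul_self := fun a => by
        simp only [star_smul, smul_mul_assoc, mul_smul_comm, smul_smul]
        rw [hz, one_smul, i.isRep.star_mul_self]
      star_mul_of_ne := fun a b h => by
        simp only [star_smul, smul_mul_assoc, mul_smul_comm, i.isRep.star_mul_of_ne a b h, smul_zero]
      regular := fun A hA => by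
        rw [i.isRep.regular A hA]
        refine finsum_congr fun a => finsum_congr fun _ => ?_
        simp only [star_smul, smul_mul_assoc, mul_smul_comm, smul_smul]
        first
        | rw [hz, one_smul]
        | rw [hz', one_smul] }

/-- The component of an element of `C*(B, L, θ)` in the twisted representation. -/
noncomputable def evTwist (i : D.CKRep) (z : Circle) : D.CStar →⋆ₙₐ[ℂ] i.C := D.ev (i.twist z)

/-- `x` is homogeneous of degree `n` for the gauge action. -/
def Homog (n : ℤ) (x : D.CStar) : Prop :=
  ∀ (z : Circle) (i : D.CKRep), evTwist i z x = ((z : ℂ) ^ n) • D.ev i x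

theorem Homog.mul {n m : ℤ} {x y : D.CStar} (hx : Homog n x) (hy : Homog m y) :
    Homog (n + m) (x * y) := by
  intro z i
  rw [map_mul, hx, hy, map_mul, smul_mul_assoc, mul_smul_comm, smul_smul, zpow_add₀ (Circle.coe_ne_zero z)]

theorem Homog.star {n : ℤ} {x : D.CStar} (hx : Homog n x) : Homog (-n) (star x) := by
  intro z i
  rw [map_star, hx, star_smul, map_star]
  congr 1
  rw [star_zpow₀, Complex.star_def, ← Circle.coe_inv_eq_conj, Circle.coe_inv, inv_zpow, zpow_neg]

theorem homog_p (A : B) : Homog (D := D) 0 (D.p A) := fun z i => by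
  rw [zpow_zero, one_smul]; rfl

theorem homog_s (a : L) : Homog (D := D) 1 (D.s a) := fun z i => by
  rw [zpow_one]; rfl

theorem homog_sMul (α : List L) {n : ℤ} {x : D.CStar} (hx : Homog n x) :
    Homog (α.length + n) (D.sMul α x) := by
  induction α with
  | nil => rw [List.length_nil, Nat.cast_zero, zero_add]; exact hx
  | cons a α ih =>
    have := (homog_s a).mul ih
    rw [List.length_cons, Nat.cast_succ, show ((α.length : ℤ) + 1 + n) = 1 + (α.length + n) by ring]
    exact this

theorem homog_elt (α : List L) (A : B) (β : List L) :
    Homog ((α.length : ℤ) - β.length) (D.elt α A β) := by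
  have := (homog_sMul α (homog_p (D := D) A)).mul (homog_sMul β (homog_p A)).star
  rwa [show ((α.length : ℤ) + 0 + -(β.length + 0)) = α.length - β.length by ring] at this

theorem Homog.unique {n m : ℤ} {x : D.CStar} (hn : Homog n x) (hm : Homog m x) (hx : x ≠ 0) :
    n = m := by
  have : ∃ i, D.ev i x ≠ 0 := by
    by_contra! h
    exact hx (D.ext_ev fun i => by rw [h i, map_zero])
  obtain ⟨i, hi⟩ := this
  have h1 : ((Circle.exp 1 : Circle) : ℂ) ^ n = ((Circle.exp 1 : Circle) : ℂ) ^ m := by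
    have := (hn (Circle.exp 1) i).symm.trans (hm (Circle.exp 1) i)
    exact smul_left_injective ℂ hi this
  have h2 : Complex.exp ((n : ℂ) * Complex.I) = Complex.exp ((m : ℂ) * Complex.I) := by
    simpa [Circle.coe_exp, ← Complex.exp_int_mul] using h1
  obtain ⟨k, hk⟩ := Complex.exp_eq_exp_iff_exists_int.1 h2
  have h3 : (n : ℂ) = m + k * (2 * Real.pi) := by
    have hI := Complex.I_ne_zero
    apply mul_right_cancel₀ hI
    rw [hk]; ring
  have h4 : (n : ℝ) = m + k * (2 * Real.pi) := by exact_mod_cast h3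
  by_cases hk0 : k = 0
  · subst hk0
    have : (n : ℝ) = m := by simpa using h4
    exact_mod_cast this
  · exfalso
    apply irrational_pi.ne_rat ((n - m : ℚ) / (2 * k))
    have : (k : ℝ) ≠ 0 := by exact_mod_cast hk0
    push_cast
    field_simp
    linarith

end gauge

section cocycle

variable {D}

/-- The degree `|α| - |β|` of `t = s_α p_A s_β^*`; it is well defined for `t ≠ 0`, see `deg_eq`. -/
noncomputable def deg (t : D.T) : ℤ :=
  let h := mem_TSet_iff.1 t.2
  (h.choose.length : ℤ) - h.choose_spec.choose_spec.choose.length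

theorem homog_deg (t : D.T) : Homog (deg t) t.1 := by
  have h := (mem_TSet_iff.1 t.2).choose_spec.choose_spec.choose_spec
  conv => arg 2; rw [h]
  exact homog_elt _ _ _

theorem deg_eq {t : D.T} (ht : t ≠ 0) {α β : List L} {A : B} (h : t.1 = D.elt α A β) :
    deg t = (α.length : ℤ) - β.length := by
  refine (homog_deg t).unique ?_ fun h0 => ht (Subtype.ext h0)
  rw [h]
  exact homog_elt _ _ _

theorem deg_mul {x y : D.T} (h : x * y ≠ 0) : deg (x * y) = deg x + deg y :=
  (homog_deg _).unique ((homog_deg x).mul (homog_deg y)) fun h0 => h (Subtype.ext h0)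

theorem deg_star {x : D.T} (h : x ≠ 0) : deg (star x) = -deg x :=
  (homog_deg (star x)).unique (homog_deg x).star fun h0 => h (Subtype.ext (star_eq_zero.1 h0))

theorem ne_zero_of_star_mul_mem {ξ : D.Gtight} {t : D.T} (h : star t * t ∈ ξ.carrier) : t ≠ 0 := by
  rintro rfl
  rw [mul_zero] at h
  exact ξ.isFilter.zero_notMem h

/-- The cocycle `c [s_α p_A s_β^*, ξ] = |α| - |β|` on the tight groupoid, see `c_germ`. -/
noncomputable def c {ξ η : D.Gtight} (γ : ξ ⟶ η) : ℤ :=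
  Quotient.lift (s := germSetoid ξ η) (fun t => deg t.val) (by
    rintro s t ⟨e, he, h⟩
    have hne : ∀ r : PreHom ξ η, r.val * e ≠ 0 := fun r h0 => by
      have h1 := ξ.isFilter.mul_mem _ r.dom _ he
      rw [mul_assoc, h0, mul_zero] at h1
      exact ξ.isFilter.zero_notMem h1
    have h2 := deg_mul (hne s)
    rw [h, deg_mul (hne t)] at h2
    exact (add_right_cancel h2).symm) γ

theorem c_germ {ξ η : D.Gtight} (t : D.T) (ht : star t * t ∈ ξ.carrier)
    (h : actSet t ξ.carrier = η.carrier) {α β : List L} {A : B} (hα : t.1 = D.elt α A β) :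
    c (germ t ht h : ξ ⟶ η) = (α.length : ℤ) - β.length :=
  deg_eq (ne_zero_of_star_mul_mem ht) hα

theorem c_comp {ξ η ζ : D.Gtight} (γ : ξ ⟶ η) (δ : η ⟶ ζ) : c (γ ≫ δ) = c γ + c δ := by
  induction γ using Quotient.inductionOn with
  | _ s =>
  induction δ using Quotient.inductionOn with
  | _ t =>
    have h : t.val * s.val ≠ 0 := ne_zero_of_star_mul_mem (s.comp t).dom
    exact (deg_mul h).trans (add_comm _ _)

theorem c_inv {ξ η : D.Gtight} (γ : ξ ⟶ η) : c (Groupoid.inv γ) = -c γ := by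
  induction γ using Quotient.inductionOn with
  | _ s => exact deg_star (ne_zero_of_star_mul_mem s.dom)

end cocycle

/-- The subgroupoid `c⁻¹(0)` of the tight groupoid. -/
noncomputable def cInvZero : Subgroupoid D.Gtight where
  arrows _ _ := {γ | c γ = 0}
  inv {_ _ γ} h := by
    change c _ = 0
    rw [c_inv, show c γ = 0 from h, neg_zero]
  mul {_ _ _ γ} h {δ} h' := by
    change c _ = 0
    rw [c_comp, show c γ = 0 from h, show c δ = 0 from h', add_zero]

/-- `c⁻¹(0)` contains all units. -/
theorem cInvZero_isWide : D.cInvZero.IsWide where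
  wide ξ := by
    change c (𝟙 ξ) = 0
    have := c_comp (𝟙 ξ) (𝟙 ξ)
    rw [Category.comp_id] at this
    omega

end BooleanDynamicalSystem

/-! An isotropy germ `[t, ξ]` can be composed with itself, so `t * t ≠ 0`. If `t = s_α p_A s_β^*`,
this forces one of `α`, `β` to be a prefix of the other; when `c [t, ξ] = |α| - |β|` vanishes, this
gives `α = β`. Then `t` is an idempotent, and the germ of an idempotent is a unit. -/

theorem isPrincipalGroupoid_iff {G : Type u} [Groupoid.{v} G] :
    IsPrincipalGroupoid G ↔ ∀ (x : G) (γ : x ⟶ x), γ = 𝟙 x := by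
  refine ⟨fun hG x γ => ?_, fun hG => Set.Subset.antisymm ?_ ?_⟩
  · have hγ : (⟨x, x, γ⟩ : Σ x y : G, x ⟶ y) ∈ unitArrows G := hG.subset rfl
    obtain ⟨y, hy⟩ := hγ
    cases hy
    rfl
  · rintro ⟨x, y, γ⟩ (rfl : x = y)
    exact ⟨x, by rw [hG x γ]⟩
  · rintro _ ⟨x, rfl⟩
    rfl

namespace InverseSemigroup₀

variable {S : Type w} [InverseSemigroup₀ S] {ξ η : TightFilter S}

theorem PreHom.val_mem_of_idem {t : PreHom ξ η} (ht : t.val * t.val = t.val) :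
    t.val ∈ ξ.carrier := by
  simpa only [star_idem ht, ht] using t.dom

theorem PreHom.equiv_of_idem {s t : PreHom ξ η} (hs : s.val * s.val = s.val)
    (ht : t.val * t.val = t.val) : s ≈ t := by
  refine ⟨s.val * t.val,
    ξ.isFilter.mul_mem _ (val_mem_of_idem hs) _ (val_mem_of_idem ht), ?_⟩
  calc s.val * (s.val * t.val) = s.val * t.val := by rw [← mul_assoc, hs]
    _ = t.val * (t.val * s.val) := by rw [← mul_assoc, ht, idem_comm hs ht]
    _ = t.val * (s.val * t.val) := by rw [idem_comm hs ht]

theorem PreHom.equiv_one_of_idem {t : PreHom ξ ξ} (ht : t.val * t.val = t.val) :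
    t ≈ PreHom.one ξ :=
  equiv_of_idem ht (ξ.isFilter.idem _ ξ.isFilter.nonempty.some_mem)

end InverseSemigroup₀

namespace BooleanDynamicalSystem

open InverseSemigroup₀

variable {B : Type u} [GeneralizedBooleanAlgebra B] {L : Type v} {D : BooleanDynamicalSystem B L}

theorem elt_mul_elt_of_le_Rng {A : B} {β : List L} (hA : (A : WithTop B) ≤ D.Rng β)
    (α γ : List L) : D.elt α A β * D.elt β A γ = D.elt α A γ := by
  calc D.elt α A β * D.elt β A γ
      = D.sMul α (D.p A) * (star (D.sMul β (D.p A)) * D.sMul β (D.p A)) *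
          star (D.sMul γ (D.p A)) := by simp only [elt, mul_assoc]
    _ = D.sMul α (D.p A) * star (D.sMul γ (D.p A)) := by
        rw [star_sMul_mul_self β A hA, sMul_mul, p_mul, inf_idem]

theorem isPrefix_or_isPrefix_of_elt_mul_elt_ne_zero {α β γ δ : List L} {A A' : B}
    (h : D.elt α A β * D.elt γ A' δ ≠ 0) : β <+: γ ∨ γ <+: β := by
  rcases elt_mul_elt α β γ δ A A' with ⟨ε, -, hγ, -⟩ | ⟨ε, -, hβ, -⟩ | h0
  · exact Or.inl ⟨ε, hγ.symm⟩
  · exact Or.inr ⟨ε, hβ.symm⟩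
  · exact absurd h0 h

theorem eq_of_elt_mul_elt_ne_zero {α β γ δ : List L} {A A' : B}
    (h : D.elt α A β * D.elt γ A' δ ≠ 0) (hlen : β.length = γ.length) : β = γ :=
  (isPrefix_or_isPrefix_of_elt_mul_elt_ne_zero h).elim (·.eq_of_length hlen)
    fun hγ => (hγ.eq_of_length hlen.symm).symm

theorem mul_self_eq_self_of_deg_eq_zero {t : D.T} (hdeg : deg t = 0) (hsq : t * t ≠ 0) :
    t * t = t := by
  have ht : t ≠ 0 := fun h => hsq (by rw [h, mul_zero])
  rcases t.2 with ⟨α, A, β, hA, -, htA⟩ | h0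
  · have hlen : β.length = α.length := by
      rw [deg_eq ht htA] at hdeg
      omega
    have hsqA : D.elt α A β * D.elt α A β ≠ 0 := by
      rw [← htA]
      exact fun h => hsq (Subtype.ext h)
    obtain rfl : β = α := eq_of_elt_mul_elt_ne_zero hsqA hlen
    apply Subtype.ext
    change t.1 * t.1 = t.1
    rw [htA, elt_mul_elt_of_le_Rng (hA.trans inf_le_left)]
  · exact absurd (Subtype.ext (Set.mem_singleton_iff.1 h0)) ht

theorem eq_id_of_c_eq_zero {ξ : D.Gtight} (γ : ξ ⟶ ξ) (hγ : c γ = 0) : γ = 𝟙 ξ := by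
  induction γ using Quotient.inductionOn with
  | _ t =>
    have hsq : t.val * t.val ≠ 0 := ne_zero_of_star_mul_mem (t.comp t).dom
    have hidem : t.val * t.val = t.val := mul_self_eq_self_of_deg_eq_zero hγ hsq
    exact Quotient.sound (PreHom.equiv_one_of_idem hidem)

end BooleanDynamicalSystem

theorem lemma7p3 {B : Type u} [GeneralizedBooleanAlgebra B] {L : Type v}
    (D : BooleanDynamicalSystem B L) :
    IsPrincipalGroupoid D.cInvZero.objs :=
  isPrincipalGroupoid_iff.2 fun _ γ =>
    Subtype.ext (BooleanDynamicalSystem.eq_id_of_c_eq_zero γ.1 γ.2)
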